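/- Let $a>0$. For $\epsilon\ge 0$ consider the rescaled Brusselator system \[ \begin{aligned} \dot\theta&=-ar^2\sin\theta(\sin\theta-\cos\theta)+\sin\theta\cos\theta(\sin\theta-\cos\theta)^2+\epsilon\left[-r^2\cos\theta(\sin\theta-\cos\theta)+\sqrt\epsilon\,ar^3\cos\theta\right],\\ \dot r&=-ar^3\cos\theta(\sin\theta-\cos\theta)+r\cos^2\theta(\sin\theta-\cos\theta)^2+\epsilon\left[r^3\sin\theta(\sin\theta-\cos\theta)-\sqrt\epsilon\,ar^4\sin\theta\right]. \end{aligned} \] For $\epsilon=0$ the graph $S^2_0$ of $\phi_0(\theta)=\sqrt{\cos\theta(\sin\theta-\cos\theta)/a}$ consists of equilibria; it is attracting for $\theta\in(\arctan 2,\pi/2]$. Let $\arctan 2<\theta_1<\theta_2\le\pi/2$. A slow manifold over $[\theta_1,\theta_2]$ is a family of compact embedded $C^1$ arcs $S^2_\epsilon$ ($\epsilon>0$ small) that converges, as $\epsilon\to0$, in the $C^1$ topology (through parametrisations by $[0,1]$) to the arc $\{(\theta,\phi_0(\theta)):\theta_1\le\theta\le\theta_2\}$, and is locally invariant: the trajectory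 through each point of $S^2_\epsilon$ other than its boundary points stays in $S^2_\epsilon$ for a short time, forwards and backwards. Here the boundary points are the two end points of the arc, except that if $\theta_2=\pi/2$ (so that the limiting arc ends in the equilibrium $(\pi/2,0)$ on the invariant line $r=0$) only the end point near $(\theta_1,\phi_0(\theta_1))$ counts as a boundary point. Proposition. Let $S^2_\epsilon$ be any slow manifold over $[\theta_1,\theta_2]$. Then there are $l_\epsilon\to\theta_1$ and $u_\epsilon\to\theta_2$, with $u_\epsilon=\pi/2$ for all small $\epsilon$ if $\theta_2=\pi/2$, such that for every sufficiently small $\epsilon>0$ the arc $S^2_\epsilon$ is the graph of a function $\phi_\epsilon:[l_\epsilon,u_\epsilon]\to\mathbb R$, and \[ \phi_\epsilon(\theta)=\phi_0(\theta)+\epsilon\,\phi_1(\theta)+o(\epsilon),\qquad \phi_1(\theta)=-\frac{\phi_0(\theta)\cos\theta}{2a(2\cos\theta-\sin\theta)}, \] as $\epsilon\to0$, uniformly in $\theta\in[l_\epsilon,u_\epsilon]$. In particular $\phi_\epsilon=\phi_0+\Theta(\epsilon)$ for $\theta$ bounded away from $\pi/2$ and $\arctan 2$: for all $\alpha>\arctan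 2$ and $\beta<\pi/2$ there are $c,C>0$ with $c\,\epsilon\le|\phi_\epsilon(\theta)-\phi_0(\theta)|\le C\,\epsilon$ for every sufficiently small $\epsilon>0$ and every $\theta\in[l_\epsilon,u_\epsilon]\cap[\alpha,\beta]$. -/

import Mathlib

open Set Filter Topology

namespace Brusselator

noncomputable section

/-- The rescaled Brusselator vector field in the coordinates `z = (θ, r)`. -/
def vectorField (a ε : ℝ) (z : ℝ × ℝ) : ℝ × ℝ :=
  let s := Real.sin z.1
  let c := Real.cos z.1
  let r := z.2
  let g₁ := -r ^ 2 * c * (s - c) + Real.sqrt ε * (a * r ^ 3 * c)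
  let g₂ := r ^ 3 * s * (s - c) - Real.sqrt ε * (a * r ^ 4 * s)
  (-(a * r ^ 2 * s * (s - c)) + s * c * (s - c) ^ 2 + ε * g₁,
   -(a * r ^ 3 * c * (s - c)) + r * c ^ 2 * (s - c) ^ 2 + ε * g₂)

/-- The branch `S²₀` of the critical manifold is the graph of `φ₀`. -/
def phi0 (a θ : ℝ) : ℝ :=
  Real.sqrt (Real.cos θ * (Real.sin θ - Real.cos θ) / a)

/-- The first order coefficient. -/
def phi1 (a θ : ℝ) : ℝ :=
  -(phi0 a θ * Real.cos θ) / (2 * a * (2 * Real.cos θ - Real.sin θ))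

/-- The compact arc of `S²₀` that lies over `[θ₁, θ₂]`. -/
def criticalArc (a θ₁ θ₂ : ℝ) : Set (ℝ × ℝ) :=
  (fun θ => (θ, phi0 a θ)) '' Icc θ₁ θ₂

/-- `γ` restricted to `[0, 1]` is a `C¹` embedding: a parametrisation of a compact
embedded `C¹` curve with two end points. -/
structure IsC1Arc (γ : ℝ → ℝ × ℝ) : Prop where
  contDiffOn : ContDiffOn ℝ 1 γ (Icc 0 1)
  injOn : InjOn γ (Icc 0 1)
  regular : ∀ t ∈ Icc (0 : ℝ) 1, derivWithin γ (Icc 0 1) t ≠ 0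

/-- A trajectory of the vector field `F` through `z` stays in `M` for a short time, forwards
and backwards. -/
def IsLocallyInvariantAt (F : ℝ × ℝ → ℝ × ℝ) (M : Set (ℝ × ℝ)) (z : ℝ × ℝ) : Prop :=
  ∃ δ > 0, ∃ X : ℝ → ℝ × ℝ, X 0 = z ∧
    ∀ s ∈ Ioo (-δ) δ, HasDerivAt X (F (X s)) s ∧ X s ∈ M

/-- `S ε`, for `ε > 0` small, is a slow manifold that perturbs the arc of `S²₀` over
`[θ₁, θ₂]`: a compact embedded `C¹` curve that is locally invariant (trajectories can leave it
only through its boundary) and converges in the `C¹` topology, as `ε → 0`, to that arc.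

`γ₀` parametrises the arc of `S²₀`, starting at the end over `θ₂`; `γ ε` parametrises `S ε`.
The two end points of `S ε` are boundary points, through which trajectories may leave, with one
exception: if `θ₂ = π / 2`, the arc ends in the equilibrium `(π / 2, 0)` on the invariant
line `r = 0` that bounds the phase space, and no trajectory may leave `S ε` at that end. -/
def IsSlowManifold (a θ₁ θ₂ : ℝ) (S : ℝ → Set (ℝ × ℝ)) : Prop :=
  ∃ (γ₀ : ℝ → ℝ × ℝ) (γ : ℝ → ℝ → ℝ × ℝ),
    IsC1Arc γ₀ ∧ γ₀ '' Icc 0 1 = criticalArc a θ₁ θ₂ ∧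
    γ₀ 0 = (θ₂, phi0 a θ₂) ∧ γ₀ 1 = (θ₁, phi0 a θ₁) ∧
    (∀ᶠ ε in 𝓝[>] (0 : ℝ), IsC1Arc (γ ε) ∧ S ε = γ ε '' Icc 0 1 ∧
      (∀ t ∈ Ioo (0 : ℝ) 1, IsLocallyInvariantAt (vectorField a ε) (S ε) (γ ε t)) ∧
      (θ₂ = Real.pi / 2 → IsLocallyInvariantAt (vectorField a ε) (S ε) (γ ε 0))) ∧
    TendstoUniformlyOn γ γ₀ (𝓝[>] 0) (Icc 0 1) ∧
    TendstoUniformlyOn (fun ε => derivWithin (γ ε) (Icc 0 1)) (derivWithin γ₀ (Icc 0 1))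
      (𝓝[>] 0) (Icc 0 1)

end

end Brusselator

namespace Brusselator

/-! Write `s`, `c` for sine and cosine of `θ`, `F` for the vector field and `v` for a tangent vector
of the slow manifold. Local invariance makes `F` parallel to `v` (`IsC1Arc.tangent`). The resulting
determinant equation factors (`det_vectorField`): with `D = (s - c) * fastDet` it reads `(c (s - c)
- a r²) D = ε r² slowDet`, that is `a (r² - φ₀²) = ε r² q` with `q = -slowDet / D`. The critical arc
is transverse to the fast flow, even at `(π / 2, 0)` (`IsC1Arc.fastDet_pos`), so `D` stays away from
0 and C¹ convergence makes `q` uniformly close to `c / (s - 2c)` (`slowDet_of_critical`). The factor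
`r²` allows solving for `r` without dividing by `φ₀`, so the expansion is uniform up to `r = 0`
(`abs_sub_expansion_le`).

It remains to see that the arc is a graph. If `θ₂ < π / 2`, C¹ closeness suffices. If `θ₂ = π / 2`,
the critical arc ends vertically and closeness says nothing there. On the slow manifold `r` is
smallest at that end, so invariance makes the `r`-component of `F` vanish there; tangency then makes
the end an equilibrium, which can only be `(π / 2, 0)`. Along the rest of the arc `F.1` has the sign
of the derivative of `θ` (`vectorField_fst_mul_fastDet`), and near the equilibrium it decreases
strictly through each critical point of `θ`. Hence `θ` increases just before a critical point. Since
`θ` stays below its initial value `π / 2`, a failure to decrease would put a minimum of `θ` at such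
a point, which is absurd (`deriv_neg_of_left_increasing`). -/

theorem sin_sub_two_mul_cos_pos {θ : ℝ} (h₁ : Real.arctan 2 < θ) (h₂ : θ ≤ Real.pi / 2) :
    0 < Real.sin θ - 2 * Real.cos θ := by
  have h0 : 0 < Real.arctan 2 := Real.arctan_pos.2 two_pos
  have hα : 0 < Real.cos (Real.arctan 2) := Real.cos_arctan_pos 2
  have hs : Real.sin (Real.arctan 2) = 2 * Real.cos (Real.arctan 2) := by
    have := Real.tan_mul_cos hα.ne'
    rwa [Real.tan_arctan, eq_comm] at this
  -- This sine is `cos (arctan 2) * (sin θ - 2 cos θ)`.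
  have h : 0 < Real.sin (θ - Real.arctan 2) :=
    Real.sin_pos_of_pos_of_lt_pi (by linarith) (by linarith [Real.pi_pos])
  rw [Real.sin_sub, hs] at h
  nlinarith

/-- Strict inequalities between continuous functions pass to uniform perturbations on
compact sets. -/
theorem eventually_forall_pos {E : Type*} [PseudoMetricSpace E] {K : Set ℝ} (hK : IsCompact K)
    {P₀ : ℝ → E} {P : ℝ → ℝ → E} (hP₀ : ContinuousOn P₀ K)
    (hP : TendstoUniformlyOn P P₀ (𝓝[>] 0) K) {f : ℝ × E → ℝ} (hf : Continuous f)
    (h : ∀ t ∈ K, 0 < f (0, P₀ t)) :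
    ∀ᶠ ε in 𝓝[>] (0 : ℝ), ∀ t ∈ K, 0 < f (ε, P ε t) := by
  have hc : IsCompact ((fun t => ((0 : ℝ), P₀ t)) '' K) :=
    hK.image_of_continuousOn (continuousOn_const.prodMk hP₀)
  have ho : IsOpen {p | 0 < f p} := isOpen_lt continuous_const hf
  obtain ⟨δ, hδ, hsub⟩ := hc.exists_thickening_subset_open ho (by
    rintro _ ⟨t, ht, rfl⟩; exact h t ht)
  have h1 : ∀ᶠ ε in 𝓝[>] (0 : ℝ), ε < δ :=
    (eventually_lt_nhds hδ).filter_mono nhdsWithin_le_nhds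
  filter_upwards [h1, self_mem_nhdsWithin, Metric.tendstoUniformlyOn_iff.1 hP δ hδ]
    with ε hε hpos hd t ht
  refine hsub (Metric.mem_thickening_iff.2 ⟨_, ⟨t, ht, rfl⟩, ?_⟩)
  rw [Prod.dist_eq, max_lt_iff]
  refine ⟨?_, by rw [dist_comm]; exact hd t ht⟩
  rw [Real.dist_eq, sub_zero, abs_of_pos hpos]
  exact hε

/-! ### Tangency of the vector field to an invariant arc -/

theorem IsC1Arc.hasDerivWithinAt {γ : ℝ → ℝ × ℝ} (h : IsC1Arc γ) {t : ℝ}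
    (ht : t ∈ Icc (0 : ℝ) 1) :
    HasDerivWithinAt γ (derivWithin γ (Icc 0 1) t) (Icc 0 1) t :=
  (h.contDiffOn.differentiableOn one_ne_zero t ht).hasDerivWithinAt

theorem IsC1Arc.hasDerivAt {γ : ℝ → ℝ × ℝ} (h : IsC1Arc γ) {t : ℝ}
    (ht : t ∈ Ioo (0 : ℝ) 1) :
    HasDerivAt γ (derivWithin γ (Icc 0 1) t) t :=
  (h.hasDerivWithinAt (Ioo_subset_Icc_self ht)).hasDerivAt (Icc_mem_nhds ht.1 ht.2)

theorem IsC1Arc.continuousOn_derivWithin {γ : ℝ → ℝ × ℝ} (h : IsC1Arc γ) :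
    ContinuousOn (derivWithin γ (Icc 0 1)) (Icc 0 1) :=
  h.contDiffOn.continuousOn_derivWithin (uniqueDiffOn_Icc zero_lt_one) le_rfl

/-- At a point of local invariance, the vector field is tangent to the arc. -/
theorem IsC1Arc.tangent {γ : ℝ → ℝ × ℝ} (h : IsC1Arc γ) {t : ℝ} (ht : t ∈ Icc (0 : ℝ) 1)
    {F : ℝ × ℝ → ℝ × ℝ} (hF : IsLocallyInvariantAt F (γ '' Icc 0 1) (γ t)) :
    (derivWithin γ (Icc 0 1) t).1 * (F (γ t)).2
      - (derivWithin γ (Icc 0 1) t).2 * (F (γ t)).1 = 0 := by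
  obtain ⟨δ, hδ, X, hX0, hX⟩ := hF
  set v := derivWithin γ (Icc 0 1) t
  have hmem : Ioo (-δ) δ ∈ 𝓝 (0 : ℝ) := Ioo_mem_nhds (by linarith) hδ
  -- The trajectory is pulled back to the parameter interval; outside its time interval the value
  -- `t` is a dummy.
  have hex : ∀ s, ∃ τ : Icc (0 : ℝ) 1, s ∈ Ioo (-δ) δ → γ τ = X s := by
    intro s
    by_cases hs : s ∈ Ioo (-δ) δ
    · obtain ⟨τ, hτ, e⟩ := (hX s hs).2
      exact ⟨⟨τ, hτ⟩, fun _ => e⟩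
    · exact ⟨⟨t, ht⟩, fun h => absurd h hs⟩
  choose τ hτ using hex
  have hXd : HasDerivAt X (F (γ t)) 0 := hX0 ▸ (hX 0 (mem_of_mem_nhds hmem)).1
  have hemb : IsClosedEmbedding ((Icc (0 : ℝ) 1).domRestrict γ) :=
    h.contDiffOn.continuousOn.domRestrict.isClosedEmbedding (injOn_iff_injective.1 h.injOn)
  have hτt : Tendsto τ (𝓝 0) (𝓝 ⟨t, ht⟩) := by
    rw [hemb.isInducing.tendsto_nhds_iff]
    have h1 : Tendsto X (𝓝 0) (𝓝 (γ t)) := hX0 ▸ hXd.continuousAt.tendsto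
    refine h1.congr' ?_
    filter_upwards [hmem] with s hs
    exact (hτ s hs).symm
  have hτt' : Tendsto (fun s => (τ s : ℝ)) (𝓝 0) (𝓝[Icc 0 1] t) :=
    tendsto_nhdsWithin_iff.2 ⟨(continuous_subtype_val.tendsto _).comp hτt,
      Eventually.of_forall fun s => (τ s).2⟩
  have hγ := h.hasDerivWithinAt ht
  let D : ℝ × ℝ →L[ℝ] ℝ :=
    v.1 • ContinuousLinearMap.snd ℝ ℝ ℝ - v.2 • ContinuousLinearMap.fst ℝ ℝ ℝ
  have hDv : D v = 0 := by simp [D]; ring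
  have hD : HasDerivWithinAt (fun s => D (γ s)) 0 (Icc 0 1) t := by
    have := D.hasFDerivAt.comp_hasDerivWithinAt t hγ
    rwa [show D (derivWithin γ (Icc 0 1) t) = 0 from hDv] at this
  have hD1 : (fun s => D (γ (τ s)) - D (γ t)) =o[𝓝 0] fun s => ((τ s : ℝ) - t) := by
    have := (hasDerivWithinAt_iff_isLittleO.1 hD).comp_tendsto hτt'
    simpa [Function.comp_def] using this
  -- Regularity bounds `τ - t` by the chord, hence by `s`. Differentiability of `τ` is thus never
  -- needed.
  have hbig : (fun s => ((τ s : ℝ) - t)) =O[𝓝 0] fun s => γ (τ s) - γ t := by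
    have := (hγ.isTheta_sub (h.regular t ht)).2.comp_tendsto
      (hτt'.prodMk (tendsto_const_pure (b := t)))
    simpa [Function.comp_def] using this
  have heq : (fun s => γ (τ s) - γ t) =ᶠ[𝓝 0] fun s => X s - X 0 := by
    filter_upwards [hmem] with s hs
    rw [hτ s hs, hX0]
  have hbig2 : (fun s => X s - X 0) =O[𝓝 0] fun s => s := by
    simpa using hXd.differentiableAt.isBigO_sub
  have h0 : HasDerivAt (fun s => D (X s)) 0 0 := by
    rw [hasDerivAt_iff_isLittleO]
    have h1 := hD1.trans_isBigO ((hbig.trans heq.isBigO).trans hbig2)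
    refine (h1.congr' ?_ ?_)
    · filter_upwards [hmem] with s hs
      simp [hτ s hs, hX0]
    · filter_upwards with s; simp
  have h1 : HasDerivAt (fun s => D (X s)) (D (F (γ t))) 0 := D.hasFDerivAt.comp_hasDerivAt 0 hXd
  simpa [D] using h1.unique h0

/-! ### Algebra of the invariance equation -/

/-- The determinant of `(r cos θ, sin θ)`, the direction of the fast flow, and `v`. -/
noncomputable def fastDet (z v : ℝ × ℝ) : ℝ := Real.sin z.1 * v.2 - z.2 * Real.cos z.1 * v.1

/-- The inner product of `(r sin θ, cos θ)` and `v`, times the common factor of the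
perturbation. -/
noncomputable def slowDet (a ε : ℝ) (z v : ℝ × ℝ) : ℝ :=
  (Real.sin z.1 - Real.cos z.1 - Real.sqrt ε * a * z.2) *
    (v.1 * z.2 * Real.sin z.1 + v.2 * Real.cos z.1)

/-- At `ε = 0` the field is a multiple of `(s, r c)`, and the perturbation is a multiple of `r² (-c,
r s)`; each gives one term. -/
theorem det_vectorField (a ε : ℝ) (z v : ℝ × ℝ) :
    v.1 * (vectorField a ε z).2 - v.2 * (vectorField a ε z).1 =
      ε * z.2 ^ 2 * slowDet a ε z v -
        (Real.cos z.1 * (Real.sin z.1 - Real.cos z.1) - a * z.2 ^ 2) *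
          ((Real.sin z.1 - Real.cos z.1) * fastDet z v) := by
  simp only [vectorField, slowDet, fastDet]
  ring

/-- Pairing the field with the fast direction kills its fast part, and `s² + c² = 1` simplifies the
rest. On the slow manifold, where `fastDet`, `r` and the bracket are positive, `F.1` and `v.1`
therefore have the same sign. -/
theorem vectorField_fst_mul_fastDet {a ε : ℝ} {z v : ℝ × ℝ}
    (h : v.1 * (vectorField a ε z).2 - v.2 * (vectorField a ε z).1 = 0) :
    (vectorField a ε z).1 * fastDet z v =
      ε * z.2 ^ 3 * (Real.sin z.1 - Real.cos z.1 - Real.sqrt ε * a * z.2) * v.1 := by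
  have key : Real.sin z.1 * (vectorField a ε z).2 - z.2 * Real.cos z.1 * (vectorField a ε z).1 =
      ε * z.2 ^ 3 * (Real.sin z.1 - Real.cos z.1 - Real.sqrt ε * a * z.2) := by
    simp only [vectorField]
    linear_combination (ε * z.2 ^ 3 * (Real.sin z.1 - Real.cos z.1 - Real.sqrt ε * a * z.2)) *
      Real.sin_sq_add_cos_sq z.1
  rw [← key, fastDet]
  linear_combination -Real.sin z.1 * h

/-- The `θ`-component of the vector field decreases in the direction of `r`. -/
theorem hasDerivAt_vectorField_fst {a ε : ℝ} {γ : ℝ → ℝ × ℝ} {t : ℝ} {v : ℝ × ℝ}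
    (hγ : HasDerivAt γ v t) (hv : v.1 = 0) :
    HasDerivAt (fun τ => (vectorField a ε (γ τ)).1)
      (-((γ t).2 * v.2 *
        (2 * a * Real.sin (γ t).1 * (Real.sin (γ t).1 - Real.cos (γ t).1) +
          2 * ε * Real.cos (γ t).1 * (Real.sin (γ t).1 - Real.cos (γ t).1) -
          3 * ε * Real.sqrt ε * a * (γ t).2 * Real.cos (γ t).1))) t := by
  have h1 : HasDerivAt (fun τ => (γ τ).1) 0 t := by
    have := (hasFDerivAt_fst (𝕜 := ℝ) (p := γ t)).comp_hasDerivAt t hγ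
    simpa [Function.comp_def, hv] using this
  have h2 : HasDerivAt (fun τ => (γ τ).2) v.2 t := by
    have := (hasFDerivAt_snd (𝕜 := ℝ) (p := γ t)).comp_hasDerivAt t hγ
    simpa [Function.comp_def] using this
  have hs := h1.sin
  have hc := h1.cos
  have hd := hs.sub hc
  have hsd := ((hs.mul hd).const_mul a).mul (h2.pow 2)
  have hscd := (hs.mul hc).mul (hd.pow 2)
  have hg := ((((h2.pow 2).mul hc).mul hd).const_mul (-ε)).add
    (((h2.pow 3).mul hc).const_mul (ε * Real.sqrt ε * a))
  refine ((hscd.sub hsd).add hg).congr_deriv ?_ |>.congr_of_eventuallyEq ?_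
  · simp
    ring
  · filter_upwards with τ
    simp [vectorField]
    ring

/-! ### Geometry of the critical arc -/

section CriticalArc

variable {a θ₁ θ₂ : ℝ} {γ₀ : ℝ → ℝ × ℝ}

theorem phi0_sq {a θ : ℝ} (ha : 0 < a) (hc : 0 ≤ Real.cos θ)
    (hd : 0 ≤ Real.sin θ - Real.cos θ) :
    a * phi0 a θ ^ 2 = Real.cos θ * (Real.sin θ - Real.cos θ) := by
  rw [phi0, Real.sq_sqrt (div_nonneg (mul_nonneg hc hd) ha.le)]
  field_simp

theorem cos_nonneg_of_mem {θ : ℝ} (h₁ : Real.arctan 2 < θ) (h₂ : θ ≤ Real.pi / 2) :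
    0 ≤ Real.cos θ := by
  have h0 : 0 < Real.arctan 2 := Real.arctan_pos.2 two_pos
  exact Real.cos_nonneg_of_neg_pi_div_two_le_of_le (by linarith [Real.pi_pos]) h₂

theorem sin_pos_of_mem {θ : ℝ} (h₁ : Real.arctan 2 < θ) (h₂ : θ ≤ Real.pi / 2) :
    0 < Real.sin θ := by
  have h0 : 0 < Real.arctan 2 := Real.arctan_pos.2 two_pos
  exact Real.sin_pos_of_pos_of_lt_pi (by linarith) (by linarith [Real.pi_pos])

theorem fst_mem_of_image_eq (hγ : γ₀ '' Icc 0 1 = criticalArc a θ₁ θ₂) {t : ℝ}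
    (ht : t ∈ Icc (0 : ℝ) 1) :
    (γ₀ t).1 ∈ Icc θ₁ θ₂ ∧ (γ₀ t).2 = phi0 a (γ₀ t).1 := by
  have : γ₀ t ∈ criticalArc a θ₁ θ₂ := hγ ▸ mem_image_of_mem _ ht
  obtain ⟨θ, hθ, e⟩ := this
  rw [← e]
  exact ⟨hθ, rfl⟩

/-- The critical arc lies on the curve `cos θ (sin θ - cos θ) = a r²`, hence is tangent to it. -/
theorem IsC1Arc.critical_relations (ha : 0 < a) (h₁ : Real.arctan 2 < θ₁)
    (h₂ : θ₂ ≤ Real.pi / 2) (h : IsC1Arc γ₀) (hγ : γ₀ '' Icc 0 1 = criticalArc a θ₁ θ₂) {t : ℝ}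
    (ht : t ∈ Icc (0 : ℝ) 1) :
    Real.cos (γ₀ t).1 * (Real.sin (γ₀ t).1 - Real.cos (γ₀ t).1) = a * (γ₀ t).2 ^ 2 ∧
    (Real.cos (γ₀ t).1 ^ 2 - Real.sin (γ₀ t).1 ^ 2
        + 2 * Real.sin (γ₀ t).1 * Real.cos (γ₀ t).1) * (derivWithin γ₀ (Icc 0 1) t).1 =
      2 * a * (γ₀ t).2 * (derivWithin γ₀ (Icc 0 1) t).2 := by
  have hrel : ∀ t ∈ Icc (0 : ℝ) 1,
      Real.cos (γ₀ t).1 * (Real.sin (γ₀ t).1 - Real.cos (γ₀ t).1) - a * (γ₀ t).2 ^ 2 = 0 := by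
    intro t ht
    obtain ⟨hm, hr⟩ := fst_mem_of_image_eq hγ ht
    have hA : Real.arctan 2 < (γ₀ t).1 := h₁.trans_le hm.1
    have hB : (γ₀ t).1 ≤ Real.pi / 2 := hm.2.trans h₂
    have hc := cos_nonneg_of_mem hA hB
    have := sin_sub_two_mul_cos_pos hA hB
    rw [hr, phi0_sq ha hc (by linarith), sub_self]
  refine ⟨sub_eq_zero.1 (hrel t ht), ?_⟩
  have hd := h.hasDerivWithinAt ht
  have h1 : HasDerivWithinAt (fun τ => (γ₀ τ).1) (derivWithin γ₀ (Icc 0 1) t).1 (Icc 0 1) t := by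
    exact (hasFDerivAt_fst (𝕜 := ℝ) (p := γ₀ t)).comp_hasDerivWithinAt t hd
  have h2 : HasDerivWithinAt (fun τ => (γ₀ τ).2) (derivWithin γ₀ (Icc 0 1) t).2 (Icc 0 1) t := by
    exact (hasFDerivAt_snd (𝕜 := ℝ) (p := γ₀ t)).comp_hasDerivWithinAt t hd
  have hH := (h1.cos.mul (h1.sin.sub h1.cos)).sub ((h2.pow 2).const_mul a)
  have h0 : HasDerivWithinAt (fun _ : ℝ => (0 : ℝ)) 0 (Icc 0 1) t := hasDerivWithinAt_const _ _ _
  have h0' := h0.congr (fun τ hτ => hrel τ hτ) (hrel t ht)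
  have := (uniqueDiffOn_Icc (zero_lt_one (α := ℝ)) t ht).eq_deriv _ h0' hH
  simp at this
  linear_combination -this

end CriticalArc

/-- On the critical arc the invariance equation determines the first order coefficient. -/
theorem slowDet_of_critical {a : ℝ} {z v : ℝ × ℝ}
    (h : Real.cos z.1 * (Real.sin z.1 - Real.cos z.1) = a * z.2 ^ 2)
    (hv : (Real.cos z.1 ^ 2 - Real.sin z.1 ^ 2 + 2 * Real.sin z.1 * Real.cos z.1) * v.1 =
      2 * a * z.2 * v.2) :
    slowDet a 0 z v * (Real.sin z.1 - 2 * Real.cos z.1) =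
      -(Real.cos z.1 * ((Real.sin z.1 - Real.cos z.1) * fastDet z v)) := by
  simp only [slowDet, fastDet, Real.sqrt_zero]
  linear_combination (Real.sin z.1 - Real.cos z.1) * (2 * v.2 * h - z.2 * hv)

/-- A vanishing determinant forces `v.1 = 0` whether or not `r = 0`, and then the determinant is
just `s * v.2`. -/
theorem fastDet_ne_zero_of_critical {a : ℝ} {z v : ℝ × ℝ} (hv0 : v ≠ 0)
    (h : Real.cos z.1 * (Real.sin z.1 - Real.cos z.1) = a * z.2 ^ 2)
    (hv : (Real.cos z.1 ^ 2 - Real.sin z.1 ^ 2 + 2 * Real.sin z.1 * Real.cos z.1) * v.1 =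
      2 * a * z.2 * v.2)
    (hs : 0 < Real.sin z.1) (hk : 0 < Real.sin z.1 - 2 * Real.cos z.1) :
    fastDet z v ≠ 0 := by
  intro h0
  rw [fastDet] at h0
  have h1 : v.1 * (Real.sin z.1 - 2 * Real.cos z.1) = 0 := by
    linear_combination (-v.1 * (Real.sin z.1 - 2 * Real.cos z.1)) * Real.sin_sq_add_cos_sq z.1 -
      Real.sin z.1 * hv + 2 * Real.cos z.1 * v.1 * h - 2 * a * z.2 * h0
  have h2 : v.1 = 0 := (mul_eq_zero.1 h1).resolve_right hk.ne'
  have h3 : v.2 = 0 := by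
    rw [h2] at h0
    simpa [hs.ne'] using h0
  exact hv0 (Prod.ext h2 h3)

/-- Eliminating `v.2` and `r²` leaves a cubic in `s`, `c` with the factor `s² + c²`. Where `r > 0`,
this ties the sign of the determinant to the direction of traversal. -/
theorem fastDet_mul_of_critical {a : ℝ} {z v : ℝ × ℝ}
    (h : Real.cos z.1 * (Real.sin z.1 - Real.cos z.1) = a * z.2 ^ 2)
    (hv : (Real.cos z.1 ^ 2 - Real.sin z.1 ^ 2 + 2 * Real.sin z.1 * Real.cos z.1) * v.1 =
      2 * a * z.2 * v.2) :
    2 * a * z.2 * fastDet z v = -(v.1 * (Real.sin z.1 - 2 * Real.cos z.1)) := by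
  rw [fastDet]
  linear_combination (-v.1 * (Real.sin z.1 - 2 * Real.cos z.1)) * Real.sin_sq_add_cos_sq z.1 -
      Real.sin z.1 * hv + 2 * Real.cos z.1 * v.1 * h

section CriticalArc

variable {a θ₁ θ₂ : ℝ} {γ₀ : ℝ → ℝ × ℝ}

theorem IsC1Arc.continuousOn_fastDet {γ : ℝ → ℝ × ℝ} (h : IsC1Arc γ) :
    ContinuousOn (fun t => fastDet (γ t) (derivWithin γ (Icc 0 1) t)) (Icc 0 1) := by
  have h1 := h.contDiffOn.continuousOn
  have h2 := h.continuousOn_derivWithin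
  unfold fastDet
  fun_prop

/-- The critical arc, traversed from `θ₂` to `θ₁`, is positively transverse to the fast flow. -/
theorem IsC1Arc.fastDet_pos (ha : 0 < a) (h₁ : Real.arctan 2 < θ₁) (h₁₂ : θ₁ < θ₂)
    (h₂ : θ₂ ≤ Real.pi / 2) (h : IsC1Arc γ₀) (hγ : γ₀ '' Icc 0 1 = criticalArc a θ₁ θ₂)
    (h0 : γ₀ 0 = (θ₂, phi0 a θ₂)) (h1 : γ₀ 1 = (θ₁, phi0 a θ₁)) {t : ℝ}
    (ht : t ∈ Icc (0 : ℝ) 1) :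
    0 < fastDet (γ₀ t) (derivWithin γ₀ (Icc 0 1) t) := by
  have hne : ∀ t ∈ Icc (0 : ℝ) 1, fastDet (γ₀ t) (derivWithin γ₀ (Icc 0 1) t) ≠ 0 := by
    intro t ht
    obtain ⟨hm, -⟩ := fst_mem_of_image_eq hγ ht
    obtain ⟨hr1, hr2⟩ := h.critical_relations ha h₁ h₂ hγ ht
    exact fastDet_ne_zero_of_critical (h.regular t ht) hr1 hr2
      (sin_pos_of_mem (h₁.trans_le hm.1) (hm.2.trans h₂))
      (sin_sub_two_mul_cos_pos (h₁.trans_le hm.1) (hm.2.trans h₂))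
  -- The sign is constant by connectedness, so one point decides it: the mean value theorem gives a
  -- point where `θ` decreases.
  obtain ⟨c, hc, hslope⟩ := exists_hasDerivAt_eq_slope (fun t => (γ₀ t).1)
    (fun t => (derivWithin γ₀ (Icc 0 1) t).1) zero_lt_one
    (continuous_fst.comp_continuousOn h.contDiffOn.continuousOn)
    (fun t ht => (hasFDerivAt_fst (𝕜 := ℝ) (p := γ₀ t)).comp_hasDerivAt t (h.hasDerivAt ht))
  have hc' := Ioo_subset_Icc_self hc
  have hx : (derivWithin γ₀ (Icc 0 1) c).1 < 0 := by
    rw [hslope, h0, h1]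
    simpa using h₁₂
  have hpos : 0 < fastDet (γ₀ c) (derivWithin γ₀ (Icc 0 1) c) := by
    obtain ⟨hm, hr⟩ := fst_mem_of_image_eq hγ hc'
    obtain ⟨hr1, hr2⟩ := h.critical_relations ha h₁ h₂ hγ hc'
    have e := fastDet_mul_of_critical hr1 hr2
    have hk := sin_sub_two_mul_cos_pos (h₁.trans_le hm.1) (hm.2.trans h₂)
    have hr0 : 0 ≤ 2 * a * (γ₀ c).2 := by
      rw [hr]; exact mul_nonneg (by linarith) (Real.sqrt_nonneg _)
    have : 0 < 2 * a * (γ₀ c).2 * fastDet (γ₀ c) (derivWithin γ₀ (Icc 0 1) c) := by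
      rw [e]; nlinarith
    exact pos_of_mul_pos_right this hr0
  by_contra hneg
  obtain ⟨τ, hτ, e⟩ := isPreconnected_Icc.intermediate_value ht hc' h.continuousOn_fastDet
    ⟨not_lt.1 hneg, hpos.le⟩
  exact hne τ hτ e

end CriticalArc

/-! ### The invariance equation and its positive root -/

/-- The invariance equation holds along an arc that is locally invariant in its interior. -/
theorem IsC1Arc.invariance {a ε : ℝ} {γ : ℝ → ℝ × ℝ} (h : IsC1Arc γ)
    (hinv : ∀ t ∈ Ioo (0 : ℝ) 1, IsLocallyInvariantAt (vectorField a ε) (γ '' Icc 0 1) (γ t))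
    {t : ℝ} (ht : t ∈ Icc (0 : ℝ) 1) :
    (derivWithin γ (Icc 0 1) t).1 * (vectorField a ε (γ t)).2 -
      (derivWithin γ (Icc 0 1) t).2 * (vectorField a ε (γ t)).1 = 0 := by
  have h1 := h.contDiffOn.continuousOn
  have h2 := h.continuousOn_derivWithin
  have hF : Continuous (vectorField a ε) := by unfold vectorField; fun_prop
  have hc : ContinuousOn (fun t => (derivWithin γ (Icc 0 1) t).1 * (vectorField a ε (γ t)).2 -
      (derivWithin γ (Icc 0 1) t).2 * (vectorField a ε (γ t)).1) (Icc 0 1) := by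
    fun_prop
  have heq : EqOn (fun t => (derivWithin γ (Icc 0 1) t).1 * (vectorField a ε (γ t)).2 -
      (derivWithin γ (Icc 0 1) t).2 * (vectorField a ε (γ t)).1) (fun _ => 0) (Ioo 0 1) :=
    fun t ht => h.tangent (Ioo_subset_Icc_self ht) (hinv t ht)
  -- Invariance is not assumed at the end points; the equation reaches them by continuity.
  exact heq.of_subset_closure hc continuousOn_const Ioo_subset_Icc_self
    (closure_Ioo (zero_ne_one (α := ℝ))).ge ht

/-- A first order expansion of the positive root of `a (r² - φ²) = ε r² q`. -/
theorem abs_sub_expansion_le {a ε r φ q k M R η : ℝ} (ha : 0 < a) (hε : 0 < ε) (hr : 0 ≤ r)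
    (hφ : 0 ≤ φ) (h : a * (r ^ 2 - φ ^ 2) = ε * r ^ 2 * q) (hq : |q - k| ≤ η) (hqM : |q| ≤ M)
    (hrR : r ≤ R) (hφR : φ ≤ R) (hη : 0 ≤ η) (hM : 0 ≤ M) :
    |r - (φ + ε * (φ * k / (2 * a)))| ≤ ε * (η * R / (2 * a) + ε * M ^ 2 * R / a ^ 2) := by
  have hR : 0 ≤ R := hr.trans hrR
  have hRHS : 0 ≤ ε * (η * R / (2 * a) + ε * M ^ 2 * R / a ^ 2) := by positivity
  rcases hr.eq_or_lt with rfl | hr'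
  · have : φ = 0 := by
      have : a * φ ^ 2 = 0 := by linear_combination -h
      simpa [ha.ne'] using this
    simpa [this] using hRHS
  have hs : 0 < r + φ := by linarith
  have h1 : a * (r - φ) = ε * q * (r ^ 2 / (r + φ)) := by
    field_simp
    linear_combination h
  have hquot : r ^ 2 / (r + φ) ≤ r := by
    rw [div_le_iff₀ hs]; nlinarith
  have hquot0 : 0 ≤ r ^ 2 / (r + φ) := by positivity
  have h2 : |r - φ| ≤ ε * M * R / a := by
    have : |a * (r - φ)| ≤ ε * M * R := by
      rw [h1, abs_mul, abs_mul, abs_of_pos hε, abs_of_nonneg hquot0]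
      exact mul_le_mul (mul_le_mul_of_nonneg_left hqM hε.le) (hquot.trans hrR) hquot0
        (by positivity)
    rw [abs_mul, abs_of_pos ha] at this
    rw [le_div_iff₀ ha]
    linarith
  -- The coefficient of `r - φ` is at most 1 for all `φ ≥ 0`, so no lower bound on `φ` enters.
  have h3 : r ^ 2 / (r + φ) - φ / 2 = (2 * r + φ) / (2 * (r + φ)) * (r - φ) := by
    field_simp
    ring
  have h4 : |r ^ 2 / (r + φ) - φ / 2| ≤ ε * M * R / a := by
    rw [h3, abs_mul, abs_of_nonneg (by positivity)]
    refine le_trans (mul_le_of_le_one_left (abs_nonneg _) ?_) h2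
    rw [div_le_one (by positivity)]
    linarith
  have h5 : r - (φ + ε * (φ * k / (2 * a))) =
      ε / a * (q * (r ^ 2 / (r + φ) - φ / 2) + (q - k) * (φ / 2)) := by
    have : r - φ = ε * q * (r ^ 2 / (r + φ)) / a := by
      rw [← h1]; field_simp
    linear_combination (norm := skip) this
    field_simp
    ring
  have h6 : |q * (r ^ 2 / (r + φ) - φ / 2) + (q - k) * (φ / 2)| ≤
      M * (ε * M * R / a) + η * (R / 2) := by
    refine (abs_add_le _ _).trans (add_le_add ?_ ?_)
    · rw [abs_mul]
      exact mul_le_mul hqM h4 (abs_nonneg _) hM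
    · rw [abs_mul, abs_of_nonneg (by positivity : 0 ≤ φ / 2)]
      exact mul_le_mul hq (by linarith) (by positivity) hη
  rw [h5, abs_mul, abs_of_pos (div_pos hε ha)]
  refine (mul_le_mul_of_nonneg_left h6 (by positivity)).trans (le_of_eq ?_)
  field_simp
  ring

/-! ### Transfer of open conditions from the critical arc -/

/-- A family of parametrised arcs that exhibits a slow manifold over `[θ₁, θ₂]`. -/
structure IsSlowFamily (a θ₁ θ₂ : ℝ) (γ₀ : ℝ → ℝ × ℝ) (γ : ℝ → ℝ → ℝ × ℝ) : Prop where
  pos : 0 < a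
  arctan_lt : Real.arctan 2 < θ₁
  lt : θ₁ < θ₂
  le_pi_div_two : θ₂ ≤ Real.pi / 2
  arc₀ : IsC1Arc γ₀
  image₀ : γ₀ '' Icc 0 1 = criticalArc a θ₁ θ₂
  apply_zero : γ₀ 0 = (θ₂, phi0 a θ₂)
  apply_one : γ₀ 1 = (θ₁, phi0 a θ₁)
  eventually_arc : ∀ᶠ ε in 𝓝[>] (0 : ℝ), IsC1Arc (γ ε) ∧
    (∀ t ∈ Ioo (0 : ℝ) 1,
      IsLocallyInvariantAt (vectorField a ε) (γ ε '' Icc 0 1) (γ ε t)) ∧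
    (θ₂ = Real.pi / 2 → IsLocallyInvariantAt (vectorField a ε) (γ ε '' Icc 0 1) (γ ε 0))
  tendsto : TendstoUniformlyOn γ γ₀ (𝓝[>] 0) (Icc 0 1)
  tendsto_deriv : TendstoUniformlyOn (fun ε => derivWithin (γ ε) (Icc 0 1))
    (derivWithin γ₀ (Icc 0 1)) (𝓝[>] 0) (Icc 0 1)

namespace IsSlowFamily

variable {a θ₁ θ₂ : ℝ} {γ₀ : ℝ → ℝ × ℝ} {γ : ℝ → ℝ → ℝ × ℝ}

/-- Every strict inequality on position and tangent used below is checked only at `ε = 0` on the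
critical arc. -/
theorem eventually_pos (h : IsSlowFamily a θ₁ θ₂ γ₀ γ) {K : Set ℝ} (hK : IsCompact K)
    (hK1 : K ⊆ Icc 0 1) (f : ℝ → ℝ × ℝ → ℝ × ℝ → ℝ)
    (hf : Continuous fun p : ℝ × (ℝ × ℝ) × (ℝ × ℝ) => f p.1 p.2.1 p.2.2)
    (h0 : ∀ t ∈ K, 0 < f 0 (γ₀ t) (derivWithin γ₀ (Icc 0 1) t)) :
    ∀ᶠ ε in 𝓝[>] (0 : ℝ), ∀ t ∈ K, 0 < f ε (γ ε t) (derivWithin (γ ε) (Icc 0 1) t) := by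
  refine eventually_forall_pos (P₀ := fun t => (γ₀ t, derivWithin γ₀ (Icc 0 1) t))
    (P := fun ε t => (γ ε t, derivWithin (γ ε) (Icc 0 1) t)) hK
    ((h.arc₀.contDiffOn.continuousOn.prodMk h.arc₀.continuousOn_derivWithin).mono hK1) ?_ hf h0
  rw [Metric.tendstoUniformlyOn_iff]
  intro δ hδ
  filter_upwards [Metric.tendstoUniformlyOn_iff.1 h.tendsto δ hδ,
    Metric.tendstoUniformlyOn_iff.1 h.tendsto_deriv δ hδ] with ε h1 h2 t ht
  exact max_lt (h1 t (hK1 ht)) (h2 t (hK1 ht))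

section Critical

variable (h : IsSlowFamily a θ₁ θ₂ γ₀ γ) {t : ℝ} (ht : t ∈ Icc (0 : ℝ) 1)
include h ht

theorem arctan_lt_fst : Real.arctan 2 < (γ₀ t).1 :=
  h.arctan_lt.trans_le (fst_mem_of_image_eq h.image₀ ht).1.1

theorem fst_le : (γ₀ t).1 ≤ Real.pi / 2 :=
  (fst_mem_of_image_eq h.image₀ ht).1.2.trans h.le_pi_div_two

theorem sin_pos : 0 < Real.sin (γ₀ t).1 := sin_pos_of_mem (h.arctan_lt_fst ht) (h.fst_le ht)

theorem cos_nonneg : 0 ≤ Real.cos (γ₀ t).1 :=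
  cos_nonneg_of_mem (h.arctan_lt_fst ht) (h.fst_le ht)

theorem sin_sub_two_cos_pos : 0 < Real.sin (γ₀ t).1 - 2 * Real.cos (γ₀ t).1 :=
  sin_sub_two_mul_cos_pos (h.arctan_lt_fst ht) (h.fst_le ht)

theorem sin_sub_cos_pos : 0 < Real.sin (γ₀ t).1 - Real.cos (γ₀ t).1 := by
  linarith [h.sin_sub_two_cos_pos ht, h.cos_nonneg ht]

theorem snd_eq : (γ₀ t).2 = phi0 a (γ₀ t).1 := (fst_mem_of_image_eq h.image₀ ht).2

theorem fastDet_pos : 0 < fastDet (γ₀ t) (derivWithin γ₀ (Icc 0 1) t) :=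
  h.arc₀.fastDet_pos h.pos h.arctan_lt h.lt h.le_pi_div_two h.image₀ h.apply_zero h.apply_one ht

theorem snd_pos (hlt : (γ₀ t).1 < Real.pi / 2) : 0 < (γ₀ t).2 := by
  have h0 : 0 < Real.arctan 2 := Real.arctan_pos.2 two_pos
  have hc : 0 < Real.cos (γ₀ t).1 :=
    Real.cos_pos_of_mem_Ioo ⟨by linarith [h.arctan_lt_fst ht, Real.pi_pos], hlt⟩
  rw [h.snd_eq ht]
  exact Real.sqrt_pos.2 (div_pos (mul_pos hc (h.sin_sub_cos_pos ht)) h.pos)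

theorem deriv_fst_neg (hlt : (γ₀ t).1 < Real.pi / 2) :
    (derivWithin γ₀ (Icc 0 1) t).1 < 0 := by
  obtain ⟨h1, h2⟩ := h.arc₀.critical_relations h.pos h.arctan_lt h.le_pi_div_two h.image₀ ht
  have e := fastDet_mul_of_critical h1 h2
  have hp : 0 < 2 * a * (γ₀ t).2 * fastDet (γ₀ t) (derivWithin γ₀ (Icc 0 1) t) :=
    mul_pos (mul_pos (mul_pos two_pos h.pos) (h.snd_pos ht hlt)) (h.fastDet_pos ht)
  by_contra! hn
  linarith [mul_nonneg hn (h.sin_sub_two_cos_pos ht).le]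

/-- The arc meets `θ = π / 2` at most at its end over `θ₂`, which injectivity reserves for the
parameter 0. -/
theorem fst_lt_of_pos (ht0 : 0 < t) : (γ₀ t).1 < Real.pi / 2 := by
  refine lt_of_le_of_ne (h.fst_le ht) fun e => ht0.ne' ?_
  have hle := (fst_mem_of_image_eq h.image₀ ht).1.2
  have h2 : (γ₀ t).1 = θ₂ := le_antisymm hle (e ▸ h.le_pi_div_two)
  refine h.arc₀.injOn ht (left_mem_Icc.2 zero_le_one) ?_
  rw [h.apply_zero]
  exact Prod.ext h2 (by rw [h.snd_eq ht, h2])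

end Critical

/-- The invariance equation, for all small `ε`. -/
theorem eventually_invariance (h : IsSlowFamily a θ₁ θ₂ γ₀ γ) :
    ∀ᶠ ε in 𝓝[>] (0 : ℝ), ∀ t ∈ Icc (0 : ℝ) 1,
      (derivWithin (γ ε) (Icc 0 1) t).1 * (vectorField a ε (γ ε t)).2 -
        (derivWithin (γ ε) (Icc 0 1) t).2 * (vectorField a ε (γ ε t)).1 = 0 := by
  filter_upwards [h.eventually_arc] with ε hε t ht
  exact hε.1.invariance hε.2.1 ht

theorem eventually_arctan_lt (h : IsSlowFamily a θ₁ θ₂ γ₀ γ) :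
    ∀ᶠ ε in 𝓝[>] (0 : ℝ), ∀ t ∈ Icc (0 : ℝ) 1, Real.arctan 2 < (γ ε t).1 := by
  filter_upwards [h.eventually_pos isCompact_Icc subset_rfl (fun _ z _ => z.1 - Real.arctan 2)
    (by fun_prop) fun t ht => sub_pos.2 (h.arctan_lt_fst ht)] with ε hε t ht
  exact sub_pos.1 (hε t ht)

theorem eventually_fastDet_pos (h : IsSlowFamily a θ₁ θ₂ γ₀ γ) :
    ∀ᶠ ε in 𝓝[>] (0 : ℝ), ∀ t ∈ Icc (0 : ℝ) 1,
      0 < fastDet (γ ε t) (derivWithin (γ ε) (Icc 0 1) t) :=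
  h.eventually_pos isCompact_Icc subset_rfl (fun _ z v => fastDet z v)
    (by unfold fastDet; fun_prop) fun _ ht => h.fastDet_pos ht

theorem eventually_sin_sub_cos_pos (h : IsSlowFamily a θ₁ θ₂ γ₀ γ) :
    ∀ᶠ ε in 𝓝[>] (0 : ℝ), ∀ t ∈ Icc (0 : ℝ) 1,
      0 < Real.sin (γ ε t).1 - Real.cos (γ ε t).1 :=
  h.eventually_pos isCompact_Icc subset_rfl (fun _ z _ => Real.sin z.1 - Real.cos z.1)
    (by fun_prop) fun _ ht => h.sin_sub_cos_pos ht

theorem eventually_drift_pos (h : IsSlowFamily a θ₁ θ₂ γ₀ γ) :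
    ∀ᶠ ε in 𝓝[>] (0 : ℝ), ∀ t ∈ Icc (0 : ℝ) 1,
      0 < Real.sin (γ ε t).1 - Real.cos (γ ε t).1 - Real.sqrt ε * a * (γ ε t).2 :=
  h.eventually_pos isCompact_Icc subset_rfl
    (fun ε z _ => Real.sin z.1 - Real.cos z.1 - Real.sqrt ε * a * z.2)
    (by fun_prop) fun _ ht => by simpa using h.sin_sub_cos_pos ht

/-- Away from the equilibrium `(π / 2, 0)`, the radius is positive and the angle decreases. -/
theorem eventually_of_lt (h : IsSlowFamily a θ₁ θ₂ γ₀ γ) {K : Set ℝ} (hK : IsCompact K)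
    (hK1 : K ⊆ Icc 0 1) (hlt : ∀ t ∈ K, (γ₀ t).1 < Real.pi / 2) :
    ∀ᶠ ε in 𝓝[>] (0 : ℝ), ∀ t ∈ K, 0 < (γ ε t).2 ∧ (γ ε t).1 < Real.pi / 2 ∧
      (derivWithin (γ ε) (Icc 0 1) t).1 < 0 := by
  filter_upwards [h.eventually_pos hK hK1 (fun _ z _ => z.2) (by fun_prop)
      fun t ht => h.snd_pos (hK1 ht) (hlt t ht),
    h.eventually_pos hK hK1 (fun _ z _ => Real.pi / 2 - z.1) (by fun_prop)
      fun t ht => sub_pos.2 (hlt t ht),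
    h.eventually_pos hK hK1 (fun _ _ v => -v.1) (by fun_prop)
      fun t ht => neg_pos.2 (h.deriv_fst_neg (hK1 ht) (hlt t ht))] with ε h1 h2 h3 t ht
  exact ⟨h1 t ht, sub_pos.1 (h2 t ht), neg_pos.1 (h3 t ht)⟩

end IsSlowFamily

/-! ### The graph property up to the equilibrium -/

/-- A function on `[0, b]` whose critical points are approached from below on their left, and
which stays below its initial value, has negative derivative. -/
theorem deriv_neg_of_left_increasing {x x' : ℝ → ℝ} {b : ℝ} (hb : 0 < b)
    (hx : ContinuousOn x (Icc 0 b)) (hx' : ∀ t ∈ Ioc 0 b, HasDerivAt x (x' t) t)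
    (hlt : ∀ t ∈ Ioc 0 b, x t < x 0)
    (hcrit : ∀ t ∈ Ioc 0 b, x' t = 0 → ∀ᶠ τ in 𝓝[<] t, x τ < x t) : x' b < 0 := by
  by_contra! hn
  obtain ⟨m, hm, hmin⟩ := isCompact_Icc.exists_isMinOn (nonempty_Icc.2 hb.le) hx
  have hbm : b ∈ Ioc 0 b := right_mem_Ioc.2 hb
  have hm0 : 0 < m := by
    refine lt_of_le_of_ne hm.1 fun e => ?_
    have h1 : x m ≤ x b := hmin (right_mem_Icc.2 hb.le)
    rw [← e] at h1
    exact absurd h1 (not_le.2 (hlt b hbm))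
  have hm' : m ∈ Ioc 0 b := ⟨hm0, hm.2⟩
  have hcm : x' m = 0 := by
    -- At `m = b` minimality excludes a positive derivative and `hn` a negative one; an interior
    -- minimum is critical by Fermat.
    rcases hm.2.eq_or_lt with e | hlt'
    · refine le_antisymm ?_ (e ▸ hn)
      by_contra! hpos
      have h1 : ∀ᶠ τ in 𝓝[<] m, x τ < x m := by
        have := (hasDerivAt_iff_tendsto_slope.1 (hx' m hm')).eventually_const_lt hpos
        have h2 : ∀ᶠ τ in 𝓝[<] m, 0 < slope x m τ :=
          this.filter_mono (nhdsWithin_mono _ fun τ hτ => ne_of_lt hτ)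
        filter_upwards [h2, self_mem_nhdsWithin] with τ hτ hτm
        rw [slope_def_field] at hτ
        have hτm : τ < m := hτm
        by_contra! hge
        exact absurd hτ (not_lt.2 (div_nonpos_of_nonneg_of_nonpos (by linarith) (by linarith)))
      obtain ⟨τ, h2, h3⟩ := (h1.and (Ioo_mem_nhdsLT hm0)).exists
      have h4 : x m ≤ x τ := hmin ⟨h3.1.le, h3.2.le.trans hm.2⟩
      linarith
    · exact (hmin.isLocalMin (Icc_mem_nhds hm0 hlt')).hasDerivAt_eq_zero (hx' m hm')
  obtain ⟨τ, h2, h3⟩ := ((hcrit m hm' hcm).and (Ioo_mem_nhdsLT hm0)).exists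
  have h4 : x m ≤ x τ := hmin ⟨h3.1.le, h3.2.le.trans hm.2⟩
  linarith

/-- Near the positive `θ`-range the only equilibrium is `(π / 2, 0)`. -/
theorem eq_of_vectorField_eq_zero {a ε : ℝ} {z : ℝ × ℝ} (hε : 0 < ε)
    (h : vectorField a ε z = 0)
    (he : 0 < Real.sin z.1 - Real.cos z.1 - Real.sqrt ε * a * z.2)
    (hd : 0 < Real.sin z.1 - Real.cos z.1) (hz : 0 < z.1) (hz' : z.1 < Real.pi) :
    z = (Real.pi / 2, 0) := by
  have h1 : (vectorField a ε z).1 = 0 := by rw [h]; rfl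
  have h2 : (vectorField a ε z).2 = 0 := by rw [h]; rfl
  have key : ε * z.2 ^ 3 * (Real.sin z.1 - Real.cos z.1 - Real.sqrt ε * a * z.2) = 0 := by
    -- For `v = (1, 0)` the tangency hypothesis only says that the second component vanishes.
    have := vectorField_fst_mul_fastDet (a := a) (ε := ε) (z := z) (v := (1, 0))
      (by simp [h1, h2])
    rw [h1] at this
    simpa using this.symm
  have hr : z.2 = 0 := by simpa [hε.ne', he.ne'] using key
  have hs := Real.sin_pos_of_pos_of_lt_pi hz hz'
  have hc : Real.cos z.1 = 0 := by
    simpa [vectorField, hr, hs.ne', hd.ne'] using h1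
  refine Prod.ext (Real.injOn_cos ⟨hz.le, hz'.le⟩ ⟨by positivity, by linarith [Real.pi_pos]⟩ ?_) hr
  rw [hc, Real.cos_pi_div_two]

namespace IsSlowFamily

variable {a θ₁ θ₂ : ℝ} {γ₀ : ℝ → ℝ × ℝ} {γ : ℝ → ℝ → ℝ × ℝ}

/-- If the critical arc ends in the equilibrium `(π / 2, 0)`, it does so vertically. -/
theorem deriv_snd_zero_pos (h : IsSlowFamily a θ₁ θ₂ γ₀ γ) (hθ : θ₂ = Real.pi / 2) :
    0 < (derivWithin γ₀ (Icc 0 1) 0).2 := by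
  have := h.fastDet_pos (left_mem_Icc.2 zero_le_one)
  simpa [fastDet, h.apply_zero, hθ, phi0] using this

/-- Near the equilibrium `(π / 2, 0)`, the radius increases along the arc. -/
theorem exists_eventually_deriv_snd_pos (h : IsSlowFamily a θ₁ θ₂ γ₀ γ)
    (hθ : θ₂ = Real.pi / 2) :
    ∃ t₀ ∈ Ioo (0 : ℝ) 1, ∀ᶠ ε in 𝓝[>] (0 : ℝ), ∀ t ∈ Icc 0 t₀,
      0 < (derivWithin (γ ε) (Icc 0 1) t).2 := by
  have hc : ContinuousWithinAt (fun t => (derivWithin γ₀ (Icc 0 1) t).2) (Icc 0 1) 0 :=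
    (continuous_snd.comp_continuousOn h.arc₀.continuousOn_derivWithin) 0
      (left_mem_Icc.2 zero_le_one)
  have h1 := hc.eventually_const_lt (h.deriv_snd_zero_pos hθ)
  obtain ⟨δ, hδ, hsub⟩ := Metric.mem_nhdsWithin_iff.1 h1
  have hm : 0 < min (δ / 2) (1 / 2) := lt_min (by linarith) (by norm_num)
  have hm1 : min (δ / 2) (1 / 2) < 1 := (min_le_right _ _).trans_lt (by norm_num)
  have hsub' : Icc 0 (min (δ / 2) (1 / 2)) ⊆ Icc (0 : ℝ) 1 := Icc_subset_Icc_right hm1.le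
  refine ⟨_, ⟨hm, hm1⟩, h.eventually_pos isCompact_Icc hsub' (fun _ _ v => v.2) (by fun_prop) ?_⟩
  intro t ht
  refine hsub ⟨?_, hsub' ht⟩
  rw [Metric.mem_ball, Real.dist_eq, sub_zero, abs_of_nonneg ht.1]
  linarith [ht.2, min_le_left (δ / 2) (1 / 2 : ℝ)]

theorem strictMonoOn_snd {γ : ℝ → ℝ × ℝ} (h : IsC1Arc γ) {t₀ : ℝ} (ht₀ : t₀ ∈ Ioo (0 : ℝ) 1)
    (hpos : ∀ t ∈ Icc 0 t₀, 0 < (derivWithin γ (Icc 0 1) t).2) :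
    StrictMonoOn (fun t => (γ t).2) (Icc 0 t₀) := by
  refine strictMonoOn_of_deriv_pos (convex_Icc _ _)
    ((continuous_snd.comp_continuousOn h.contDiffOn.continuousOn).mono
      (Icc_subset_Icc_right ht₀.2.le)) fun t ht => ?_
  rw [interior_Icc] at ht
  have := (hasFDerivAt_snd (𝕜 := ℝ) (p := γ t)).comp_hasDerivAt t
    (h.hasDerivAt ⟨ht.1, ht.2.trans ht₀.2⟩)
  rw [show deriv (fun t => (γ t).2) t = _ from this.deriv]
  exact hpos t (Ioo_subset_Icc_self ht)

/-- If the critical arc ends in the equilibrium `(π / 2, 0)`, so does the slow manifold, and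
the radius is positive elsewhere. -/
theorem eventually_apply_zero (h : IsSlowFamily a θ₁ θ₂ γ₀ γ) (hθ : θ₂ = Real.pi / 2) :
    ∀ᶠ ε in 𝓝[>] (0 : ℝ), γ ε 0 = (Real.pi / 2, 0) ∧ ∀ t ∈ Ioc (0 : ℝ) 1, 0 < (γ ε t).2 := by
  obtain ⟨t₀, ht₀, hd⟩ := h.exists_eventually_deriv_snd_pos hθ
  have hK1 : Icc t₀ 1 ⊆ Icc (0 : ℝ) 1 := Icc_subset_Icc_left ht₀.1.le
  have hr₀ : ∀ t ∈ Icc t₀ 1, 0 < (γ₀ t).2 := fun t ht =>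
    h.snd_pos (hK1 ht) (h.fst_lt_of_pos (hK1 ht) (ht₀.1.trans_le ht.1))
  -- Half of this minimum will separate the radius at the parameter 0 from the radii over `[t₀, 1]`.
  obtain ⟨m, hm, hmin⟩ := isCompact_Icc.exists_isMinOn (nonempty_Icc.2 ht₀.2.le)
    ((continuous_snd.comp_continuousOn h.arc₀.contDiffOn.continuousOn).mono hK1)
  have hμ : 0 < (γ₀ m).2 := hr₀ m hm
  have hz0 : (0 : ℝ) ∈ Icc (0 : ℝ) 1 := left_mem_Icc.2 zero_le_one
  filter_upwards [hd, self_mem_nhdsWithin, h.eventually_arc, h.eventually_invariance,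
    h.eventually_drift_pos, h.eventually_sin_sub_cos_pos, h.eventually_arctan_lt,
    h.eventually_pos isCompact_Icc hK1 (fun _ z _ => z.2 - (γ₀ m).2 / 2) (by fun_prop)
      (fun t ht => by
        have : (γ₀ m).2 ≤ (γ₀ t).2 := hmin ht
        linarith),
    h.eventually_pos isCompact_singleton (singleton_subset_iff.2 hz0)
      (fun _ z _ => (γ₀ m).2 / 2 - z.2) (by fun_prop)
      (by simp [h.apply_zero, hθ, phi0, hμ]),
    h.eventually_pos isCompact_singleton (singleton_subset_iff.2 hz0)
      (fun _ z _ => Real.pi - z.1) (by fun_prop)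
      (by simp [h.apply_zero, hθ, Real.pi_pos])]
    with ε hy hε harc hinv he hsc hat hfar hnear hpi
  have hmono := strictMonoOn_snd harc.1 ht₀ hy
  have h0 := hnear 0 rfl
  have hgt : ∀ t ∈ Ioc (0 : ℝ) 1, (γ ε 0).2 < (γ ε t).2 := by
    intro t ht
    rcases le_total t t₀ with hle | hle
    · exact hmono (left_mem_Icc.2 ht₀.1.le) ⟨ht.1.le, hle⟩ ht.1
    · linarith [hfar t ⟨hle, ht.2⟩]
  have hge : ∀ t ∈ Icc (0 : ℝ) 1, (γ ε 0).2 ≤ (γ ε t).2 := by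
    intro t ht
    rcases ht.1.eq_or_lt with rfl | h'
    · exact le_rfl
    · exact (hgt t ⟨h', ht.2⟩).le
  -- The trajectory stays in the arc, so its radius has a local minimum at time 0.
  have hF2 : (vectorField a ε (γ ε 0)).2 = 0 := by
    obtain ⟨δ, hδ, X, hX0, hX⟩ := harc.2.2 hθ
    have hmem : Ioo (-δ) δ ∈ 𝓝 (0 : ℝ) := Ioo_mem_nhds (by linarith) hδ
    have hXd := (hX 0 (mem_of_mem_nhds hmem)).1
    rw [hX0] at hXd
    have h2 : HasDerivAt (fun s => (X s).2) (vectorField a ε (γ ε 0)).2 0 :=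
      (hasFDerivAt_snd (𝕜 := ℝ) (p := X 0)).comp_hasDerivAt 0 hXd
    refine IsLocalMin.hasDerivAt_eq_zero ?_ h2
    filter_upwards [hmem] with s hs
    obtain ⟨τ, hτ, e⟩ := (hX s hs).2
    rw [hX0, ← e]
    exact hge τ hτ
  have hF1 : (vectorField a ε (γ ε 0)).1 = 0 := by
    have := hinv 0 hz0
    rw [hF2] at this
    simpa [(hy 0 (left_mem_Icc.2 ht₀.1.le)).ne'] using this
  have hz : γ ε 0 = (Real.pi / 2, 0) :=
    eq_of_vectorField_eq_zero hε (Prod.ext hF1 hF2) (he 0 hz0) (hsc 0 hz0)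
      ((Real.arctan_pos.2 two_pos).trans (hat 0 hz0)) (sub_pos.1 (hpi 0 rfl))
  refine ⟨hz, fun t ht => ?_⟩
  have := hgt t ht
  rwa [hz] at this

/-- The angle decreases strictly along the slow manifold, up to the equilibrium. -/
theorem eventually_monotone_of_eq (h : IsSlowFamily a θ₁ θ₂ γ₀ γ) (hθ : θ₂ = Real.pi / 2) :
    ∀ᶠ ε in 𝓝[>] (0 : ℝ), ∀ t ∈ Ioo (0 : ℝ) 1, (derivWithin (γ ε) (Icc 0 1) t).1 < 0 := by
  obtain ⟨t₀, ht₀, hd⟩ := h.exists_eventually_deriv_snd_pos hθ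
  have hK1 : Icc t₀ 1 ⊆ Icc (0 : ℝ) 1 := Icc_subset_Icc_left ht₀.1.le
  filter_upwards [hd, self_mem_nhdsWithin, h.eventually_arc, h.eventually_invariance,
    h.eventually_drift_pos, h.eventually_sin_sub_cos_pos, h.eventually_arctan_lt,
    h.eventually_fastDet_pos, h.eventually_apply_zero hθ,
    h.eventually_of_lt isCompact_Icc hK1 fun t ht =>
      h.fst_lt_of_pos (hK1 ht) (ht₀.1.trans_le ht.1),
    h.eventually_pos isCompact_Icc subset_rfl (fun _ z _ => Real.pi - z.1) (by fun_prop)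
      (fun t ht => by linarith [h.fst_le ht, Real.pi_pos]),
    h.eventually_pos isCompact_Icc subset_rfl
      (fun ε z v => a * ((Real.sin z.1 - Real.cos z.1) * fastDet z v) + ε * slowDet a ε z v)
      (by unfold fastDet slowDet; fun_prop)
      (fun t ht => by
        simpa using mul_pos h.pos (mul_pos (h.sin_sub_cos_pos ht) (h.fastDet_pos ht))),
    h.eventually_pos isCompact_Icc subset_rfl
      (fun ε z _ => 2 * a * Real.sin z.1 * (Real.sin z.1 - Real.cos z.1) +
          2 * ε * Real.cos z.1 * (Real.sin z.1 - Real.cos z.1) -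
          3 * ε * Real.sqrt ε * a * z.2 * Real.cos z.1) (by fun_prop)
      (fun t ht => by
        simpa using mul_pos (mul_pos (mul_pos two_pos h.pos) (h.sin_pos ht))
          (h.sin_sub_cos_pos ht))]
    with ε hy hε harc hinv he hsc hat hW hzero hfar hpi hsum hJ t ht
  rcases le_total t₀ t with hle | hle
  · exact (hfar t ⟨hle, ht.2.le⟩).2.2
  have hε : 0 < ε := hε
  have hIcc : ∀ τ ∈ Ioc 0 t, τ ∈ Icc (0 : ℝ) 1 := fun τ hτ => ⟨hτ.1.le, hτ.2.trans ht.2.le⟩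
  have hIoo : ∀ τ ∈ Ioc 0 t, τ ∈ Ioo (0 : ℝ) 1 := fun τ hτ => ⟨hτ.1, hτ.2.trans_lt ht.2⟩
  refine deriv_neg_of_left_increasing (x := fun τ => (γ ε τ).1)
    (x' := fun τ => (derivWithin (γ ε) (Icc 0 1) τ).1) ht.1
    ((continuous_fst.comp_continuousOn harc.1.contDiffOn.continuousOn).mono
      (Icc_subset_Icc_right ht.2.le)) (fun τ hτ =>
      (hasFDerivAt_fst (𝕜 := ℝ) (p := γ ε τ)).comp_hasDerivAt τ (harc.1.hasDerivAt (hIoo τ hτ)))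
    ?_ ?_
  · intro τ hτ
    have hi := hinv τ (hIcc τ hτ)
    rw [det_vectorField] at hi
    have hr := hzero.2 τ ⟨hτ.1, (hIcc τ hτ).2⟩
    have hD := mul_pos (hsc τ (hIcc τ hτ)) (hW τ (hIcc τ hτ))
    -- The invariance equation equates `c (s - c) D` with this positive quantity, so `c > 0` and `θ`
    -- stays below `π / 2`.
    have h1 := mul_pos (pow_pos hr 2) (hsum τ (hIcc τ hτ))
    have h2 : 0 < Real.cos (γ ε τ).1 * ((Real.sin (γ ε τ).1 - Real.cos (γ ε τ).1) *
        ((Real.sin (γ ε τ).1 - Real.cos (γ ε τ).1) *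
          fastDet (γ ε τ) (derivWithin (γ ε) (Icc 0 1) τ))) := by
      refine h1.trans_eq ?_
      linear_combination hi
    have hc : 0 < Real.cos (γ ε τ).1 :=
      pos_of_mul_pos_left h2 (mul_pos (hsc τ (hIcc τ hτ)) hD).le
    show (γ ε τ).1 < (γ ε 0).1
    rw [hzero.1]
    by_contra! hge
    exact absurd hc (not_lt.2 (Real.cos_nonpos_of_pi_div_two_le_of_le hge
      (by linarith [hpi τ (hIcc τ hτ), Real.pi_pos])))
  · intro τ hτ hcrit
    have hr := hzero.2 τ ⟨hτ.1, (hIcc τ hτ).2⟩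
    have hyτ := hy τ ⟨hτ.1.le, hτ.2.trans hle⟩
    have hsign : ∀ σ ∈ Ioc 0 t, (vectorField a ε (γ ε σ)).1 *
        fastDet (γ ε σ) (derivWithin (γ ε) (Icc 0 1) σ) =
        ε * (γ ε σ).2 ^ 3 * (Real.sin (γ ε σ).1 - Real.cos (γ ε σ).1 -
          Real.sqrt ε * a * (γ ε σ).2) * (derivWithin (γ ε) (Icc 0 1) σ).1 :=
      fun σ hσ => vectorField_fst_mul_fastDet (hinv σ (hIcc σ hσ))
    have hG0 : (vectorField a ε (γ ε τ)).1 = 0 := by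
      have := hsign τ hτ
      rw [hcrit, mul_zero] at this
      exact (mul_eq_zero.1 this).resolve_right (hW τ (hIcc τ hτ)).ne'
    have hG := hasDerivAt_vectorField_fst (a := a) (ε := ε)
      (harc.1.hasDerivAt (hIoo τ hτ)) hcrit
    have hneg := neg_neg_iff_pos.2 (mul_pos (mul_pos hr hyτ) (hJ τ (hIcc τ hτ)))
    -- `F.1` vanishes at `τ` with negative slope along the arc, so it is positive just before.
    have hev : ∀ᶠ σ in 𝓝[<] τ, 0 < (vectorField a ε (γ ε σ)).1 := by
      have h1 : ∀ᶠ σ in 𝓝[<] τ, slope (fun σ => (vectorField a ε (γ ε σ)).1) τ σ < 0 :=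
        ((hasDerivAt_iff_tendsto_slope.1 hG).eventually_lt_const hneg).filter_mono
          (nhdsWithin_mono _ fun σ hσ => ne_of_lt hσ)
      filter_upwards [h1, self_mem_nhdsWithin] with σ hσ hlt
      rw [slope_def_field, hG0, sub_zero] at hσ
      have hlt : σ < τ := hlt
      by_contra! hle'
      exact absurd hσ (not_lt.2 (div_nonneg_of_nonpos hle' (by linarith)))
    obtain ⟨σ₀, hσ₀, hsub⟩ := (mem_nhdsLT_iff_exists_Ioo_subset' hτ.1).1
      (inter_mem hev (Ioo_mem_nhdsLT hτ.1))
    have hmono : StrictMonoOn (fun σ => (γ ε σ).1) (Icc (max σ₀ 0) τ) := by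
      have hbd : ∀ σ ∈ Icc (max σ₀ 0) τ, σ ∈ Icc (0 : ℝ) 1 := fun σ hσ =>
        ⟨(le_max_right _ _).trans hσ.1, hσ.2.trans (hIcc τ hτ).2⟩
      refine strictMonoOn_of_deriv_pos (convex_Icc _ _)
        ((continuous_fst.comp_continuousOn harc.1.contDiffOn.continuousOn).mono hbd)
        fun σ hσ => ?_
      rw [interior_Icc] at hσ
      have hσ' : σ ∈ Ioc 0 t := ⟨(le_max_right _ _).trans_lt hσ.1, hσ.2.le.trans hτ.2⟩
      rw [show deriv (fun σ => (γ ε σ).1) σ = _ from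
        ((hasFDerivAt_fst (𝕜 := ℝ) (p := γ ε σ)).comp_hasDerivAt σ
          (harc.1.hasDerivAt (hIoo σ hσ'))).deriv]
      have hF : 0 < (vectorField a ε (γ ε σ)).1 :=
        (hsub ⟨(le_max_left _ _).trans_lt hσ.1, hσ.2⟩).1
      have hrσ := hzero.2 σ ⟨hσ'.1, (hIcc σ hσ').2⟩
      have hp := mul_pos hF (hW σ (hIcc σ hσ'))
      rw [hsign σ hσ'] at hp
      exact pos_of_mul_pos_right hp (mul_pos (mul_pos hε (pow_pos hrσ 3)) (he σ (hIcc σ hσ'))).le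
    have hmax : max σ₀ 0 < τ := max_lt hσ₀ hτ.1
    filter_upwards [Ioo_mem_nhdsLT hmax] with σ hσ
    exact hmono (Ioo_subset_Icc_self hσ) (right_mem_Icc.2 hmax.le) hσ.2

/-- The slow manifold is, for small `ε`, a graph over `θ` in the phase space `r ≥ 0`. -/
theorem eventually_graph (h : IsSlowFamily a θ₁ θ₂ γ₀ γ) :
    ∀ᶠ ε in 𝓝[>] (0 : ℝ), StrictAntiOn (fun t => (γ ε t).1) (Icc 0 1) ∧
      ∀ t ∈ Icc (0 : ℝ) 1, 0 ≤ (γ ε t).2 ∧ (γ ε t).1 ≤ Real.pi / 2 := by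
  have key : ∀ᶠ ε in 𝓝[>] (0 : ℝ),
      (∀ t ∈ Ioo (0 : ℝ) 1, (derivWithin (γ ε) (Icc 0 1) t).1 < 0) ∧
      (γ ε 0).1 ≤ Real.pi / 2 ∧ ∀ t ∈ Icc (0 : ℝ) 1, 0 ≤ (γ ε t).2 := by
    -- Only an arc ending at the equilibrium needs the dynamical argument.
    rcases h.le_pi_div_two.eq_or_lt with hθ | hθ
    · filter_upwards [h.eventually_monotone_of_eq hθ, h.eventually_apply_zero hθ] with ε h1 h2
      refine ⟨h1, by rw [h2.1], fun t ht => ?_⟩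
      rcases ht.1.eq_or_lt with rfl | h'
      · rw [h2.1]
      · exact (h2.2 t ⟨h', ht.2⟩).le
    · filter_upwards [h.eventually_of_lt isCompact_Icc subset_rfl fun t ht =>
        (fst_mem_of_image_eq h.image₀ ht).1.2.trans_lt hθ] with ε h1
      exact ⟨fun t ht => (h1 t (Ioo_subset_Icc_self ht)).2.2,
        (h1 0 (left_mem_Icc.2 zero_le_one)).2.1.le, fun t ht => (h1 t ht).1.le⟩
  filter_upwards [key, h.eventually_arc] with ε hk harc
  have hanti : StrictAntiOn (fun t => (γ ε t).1) (Icc 0 1) := by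
    refine strictAntiOn_of_deriv_neg (convex_Icc _ _)
      (continuous_fst.comp_continuousOn harc.1.contDiffOn.continuousOn) fun t ht => ?_
    rw [interior_Icc] at ht
    rw [show deriv (fun σ => (γ ε σ).1) t = _ from
      ((hasFDerivAt_fst (𝕜 := ℝ) (p := γ ε t)).comp_hasDerivAt t (harc.1.hasDerivAt ht)).deriv]
    exact hk.1 t ht
  refine ⟨hanti, fun t ht => ⟨hk.2.2 t ht, ?_⟩⟩
  exact (hanti.antitoneOn (left_mem_Icc.2 zero_le_one) ht ht.1).trans hk.2.1

end IsSlowFamily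

/-! ### The first order expansion -/

theorem phi0_le {a : ℝ} (ha : 0 < a) (θ : ℝ) : phi0 a θ ≤ 2 / a + 1 := by
  have h2 : Real.cos θ * (Real.sin θ - Real.cos θ) ≤ 2 := by
    nlinarith [Real.sin_sq_add_cos_sq θ, sq_nonneg (Real.sin θ - Real.cos θ)]
  have h3 : Real.cos θ * (Real.sin θ - Real.cos θ) / a ≤ 2 / a := by gcongr
  refine (Real.sqrt_le_sqrt h3).trans (Real.sqrt_le_iff.2 ⟨by positivity, ?_⟩)
  have : 0 < 2 / a := by positivity
  nlinarith

/-- This form isolates `c / (s - 2c)`, the limit of `q`. -/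
theorem phi1_eq (a θ : ℝ) :
    phi1 a θ = phi0 a θ * (Real.cos θ / (Real.sin θ - 2 * Real.cos θ)) / (2 * a) := by
  rw [phi1, ← neg_sub (Real.sin θ) (2 * Real.cos θ), mul_neg, neg_div_neg_eq, mul_div_assoc',
    div_div, mul_comm (2 * a)]

namespace IsSlowFamily

variable {a θ₁ θ₂ : ℝ} {γ₀ : ℝ → ℝ × ℝ} {γ : ℝ → ℝ → ℝ × ℝ}

theorem exists_lower_bound (h : IsSlowFamily a θ₁ θ₂ γ₀ γ) :
    ∃ m > 0, ∀ t ∈ Icc (0 : ℝ) 1, m ≤ Real.sin (γ₀ t).1 - 2 * Real.cos (γ₀ t).1 := by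
  have hc : ContinuousOn (fun t => Real.sin (γ₀ t).1 - 2 * Real.cos (γ₀ t).1) (Icc 0 1) := by
    have := h.arc₀.contDiffOn.continuousOn
    fun_prop
  obtain ⟨t, ht, hmin⟩ := isCompact_Icc.exists_isMinOn (nonempty_Icc.2 zero_le_one) hc
  exact ⟨_, h.sin_sub_two_cos_pos ht, fun s hs => hmin hs⟩

/-- The first order expansion of the slow manifold, along its parametrisation. -/
theorem eventually_expansion (h : IsSlowFamily a θ₁ θ₂ γ₀ γ) {η : ℝ} (hη : 0 < η) :
    ∀ᶠ ε in 𝓝[>] (0 : ℝ), ∀ t ∈ Icc (0 : ℝ) 1,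
      |(γ ε t).2 - (phi0 a (γ ε t).1 + ε * phi1 a (γ ε t).1)| ≤ η * ε := by
  have ha := h.pos
  obtain ⟨m, hm, hmle⟩ := h.exists_lower_bound
  -- `R` bounds `r` and `φ₀`, and `M` bounds `|q|`. The choice of `η'` and the smallness of `ε` each
  -- keep one error term below `η / 2`.
  set R : ℝ := 2 / a + 2 with hR
  have hR0 : 0 < R := by positivity
  set M : ℝ := 2 / m + 1 with hM
  have hM0 : 0 < M := by positivity
  set η' : ℝ := min 1 (η * a / R) with hη'
  have hη'0 : 0 < η' := lt_min one_pos (by positivity)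
  have hsmall : ∀ᶠ ε in 𝓝[>] (0 : ℝ), ε < η * a ^ 2 / (2 * M ^ 2 * R) :=
    (eventually_lt_nhds (by positivity)).filter_mono nhdsWithin_le_nhds
  have hbound : ∀ t ∈ Icc (0 : ℝ) 1,
      0 < η' * ((Real.sin (γ₀ t).1 - Real.cos (γ₀ t).1) *
        fastDet (γ₀ t) (derivWithin γ₀ (Icc 0 1) t)) *
          (Real.sin (γ₀ t).1 - 2 * Real.cos (γ₀ t).1) := fun t ht =>
    mul_pos (mul_pos hη'0 (mul_pos (h.sin_sub_cos_pos ht) (h.fastDet_pos ht)))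
      (h.sin_sub_two_cos_pos ht)
  have hrel : ∀ t ∈ Icc (0 : ℝ) 1,
      slowDet a 0 (γ₀ t) (derivWithin γ₀ (Icc 0 1) t) *
        (Real.sin (γ₀ t).1 - 2 * Real.cos (γ₀ t).1) =
      -(Real.cos (γ₀ t).1 * ((Real.sin (γ₀ t).1 - Real.cos (γ₀ t).1) *
        fastDet (γ₀ t) (derivWithin γ₀ (Icc 0 1) t))) := fun t ht => by
    obtain ⟨h1, h2⟩ := h.arc₀.critical_relations ha h.arctan_lt h.le_pi_div_two h.image₀ ht
    exact slowDet_of_critical h1 h2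
  filter_upwards [self_mem_nhdsWithin, hsmall, h.eventually_graph, h.eventually_invariance,
    h.eventually_sin_sub_cos_pos, h.eventually_arctan_lt, h.eventually_fastDet_pos,
    h.eventually_pos isCompact_Icc subset_rfl
      (fun _ z _ => Real.sin z.1 - 2 * Real.cos z.1 - m / 2) (by fun_prop)
      (fun t ht => by linarith [hmle t ht]),
    h.eventually_pos isCompact_Icc subset_rfl (fun _ z _ => R - z.2) (by fun_prop)
      (fun t ht => by
        rw [h.snd_eq ht]
        linarith [phi0_le ha (γ₀ t).1]),
    -- This and the next condition say `|q - k| < η'` with denominators cleared, which keeps the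
    -- functions continuous everywhere; the subtracted bracket vanishes on the critical arc by
    -- `hrel`.
    h.eventually_pos isCompact_Icc subset_rfl
      (fun ε z v => η' * ((Real.sin z.1 - Real.cos z.1) * fastDet z v) *
          (Real.sin z.1 - 2 * Real.cos z.1) -
        (slowDet a ε z v * (Real.sin z.1 - 2 * Real.cos z.1) +
          Real.cos z.1 * ((Real.sin z.1 - Real.cos z.1) * fastDet z v)))
      (by unfold fastDet slowDet; fun_prop)
      (fun t ht => by
        have := hbound t ht
        rw [hrel t ht]
        linarith),
    h.eventually_pos isCompact_Icc subset_rfl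
      (fun ε z v => η' * ((Real.sin z.1 - Real.cos z.1) * fastDet z v) *
          (Real.sin z.1 - 2 * Real.cos z.1) +
        (slowDet a ε z v * (Real.sin z.1 - 2 * Real.cos z.1) +
          Real.cos z.1 * ((Real.sin z.1 - Real.cos z.1) * fastDet z v)))
      (by unfold fastDet slowDet; fun_prop)
      (fun t ht => by
        have := hbound t ht
        rw [hrel t ht]
        linarith)]
    with ε hε hεs hgr hinv hsc hat hW hm2 hRt hup hlow t ht
  have hε : 0 < ε := hε
  have hi := hinv t ht
  rw [det_vectorField] at hi
  have hsc := hsc t ht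
  have hup := hup t ht
  have hlow := hlow t ht
  have hRt := hRt t ht
  have hm2 := hm2 t ht
  have hr := (hgr.2 t ht).1
  have hc := cos_nonneg_of_mem (hat t ht) (hgr.2 t ht).2
  have hD := mul_pos hsc (hW t ht)
  have hφ := phi0_sq ha hc hsc.le
  rw [phi1_eq]
  generalize (derivWithin (γ ε) (Icc 0 1) t) = v at *
  generalize (γ ε t) = z at *
  have hk : 0 < Real.sin z.1 - 2 * Real.cos z.1 := by linarith
  set D := (Real.sin z.1 - Real.cos z.1) * fastDet z v
  set q := -(slowDet a ε z v / D) with hq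
  set k := Real.cos z.1 / (Real.sin z.1 - 2 * Real.cos z.1) with hkdef
  have hqk : |q - k| ≤ η' := by
    have e : (q - k) * (D * (Real.sin z.1 - 2 * Real.cos z.1)) =
        -(slowDet a ε z v * (Real.sin z.1 - 2 * Real.cos z.1) + Real.cos z.1 * D) := by
      have e1 : q * D = -slowDet a ε z v := by
        rw [hq, neg_mul, div_mul_cancel₀ _ hD.ne']
      have e2 : k * (Real.sin z.1 - 2 * Real.cos z.1) = Real.cos z.1 :=
        div_mul_cancel₀ _ hk.ne'
      linear_combination (Real.sin z.1 - 2 * Real.cos z.1) * e1 - D * e2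
    have hP := mul_pos hD hk
    rw [abs_le]
    constructor
    · by_contra! hn
      nlinarith [mul_lt_mul_of_pos_right hn hP]
    · by_contra! hn
      nlinarith [mul_lt_mul_of_pos_right hn hP]
  have hk0 : 0 ≤ k := div_nonneg hc hk.le
  have hk1 : k ≤ 2 / m := by
    rw [hkdef, div_le_div_iff₀ hk hm]
    nlinarith [Real.cos_le_one z.1]
  have hη1 : η' ≤ 1 := min_le_left _ _
  have hqM : |q| ≤ M := by
    have := abs_le.1 hqk
    rw [abs_le]
    constructor
    · linarith [this.1, show (0 : ℝ) < 2 / m by positivity]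
    · linarith [this.2]
  have heq : a * (z.2 ^ 2 - phi0 a z.1 ^ 2) = ε * z.2 ^ 2 * q := by
    rw [hq, mul_sub, hφ]
    field_simp
    linear_combination hi
  have hmain := abs_sub_expansion_le ha hε hr (Real.sqrt_nonneg _) heq hqk hqM (sub_pos.1 hRt).le
    ((phi0_le ha z.1).trans (by linarith)) hη'0.le hM0.le
  refine hmain.trans ?_
  rw [mul_comm η]
  refine mul_le_mul_of_nonneg_left ?_ hε.le
  have h1 : η' * R / (2 * a) ≤ η / 2 := by
    have : η' * R ≤ η * a := (le_div_iff₀ hR0).1 (min_le_right _ _)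
    rw [div_le_div_iff₀ (by positivity) two_pos]
    linarith
  have h2 : ε * M ^ 2 * R / a ^ 2 ≤ η / 2 := by
    have := (lt_div_iff₀ (by positivity)).1 hεs
    rw [div_le_div_iff₀ (by positivity) two_pos]
    linarith
  linarith

theorem tendsto_fst (h : IsSlowFamily a θ₁ θ₂ γ₀ γ) {t : ℝ} (ht : t ∈ Icc (0 : ℝ) 1) :
    Tendsto (fun ε => (γ ε t).1) (𝓝[>] 0) (𝓝 (γ₀ t).1) :=
  (continuous_fst.tendsto _).comp (h.tendsto.tendsto_at ht)

end IsSlowFamily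

/-! ### From the parametrisation to the graph, and two-sided bounds -/

/-- The image of a curve with strictly decreasing first coordinate is a graph. -/
theorem image_eq_graph {γ : ℝ → ℝ × ℝ} (hc : ContinuousOn γ (Icc 0 1))
    (hanti : StrictAntiOn (fun t => (γ t).1) (Icc 0 1)) :
    (fun t => (γ t).1) '' Icc 0 1 = Icc (γ 1).1 (γ 0).1 ∧
    γ '' Icc 0 1 = (fun θ => (θ, (γ (Function.invFunOn (fun t => (γ t).1) (Icc 0 1) θ)).2)) ''
      Icc (γ 1).1 (γ 0).1 := by
  have himg : (fun t => (γ t).1) '' Icc 0 1 = Icc (γ 1).1 (γ 0).1 := by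
    refine Subset.antisymm ?_
      (intermediate_value_Icc' zero_le_one (continuous_fst.comp_continuousOn hc))
    rintro _ ⟨t, ht, rfl⟩
    exact ⟨hanti.antitoneOn ht (right_mem_Icc.2 zero_le_one) ht.2,
      hanti.antitoneOn (left_mem_Icc.2 zero_le_one) ht ht.1⟩
  refine ⟨himg, ?_⟩
  rw [← himg, image_image]
  refine image_congr fun t ht => ?_
  rw [hanti.injOn.leftInvOn_invFunOn ht]

theorem phi1_pos {a θ : ℝ} (ha : 0 < a) (h₁ : Real.arctan 2 < θ) (h₂ : θ < Real.pi / 2) :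
    0 < phi1 a θ := by
  have h0 : 0 < Real.arctan 2 := Real.arctan_pos.2 two_pos
  have hc : 0 < Real.cos θ := Real.cos_pos_of_mem_Ioo ⟨by linarith [Real.pi_pos], h₂⟩
  have hk := sin_sub_two_mul_cos_pos h₁ h₂.le
  have hφ : 0 < phi0 a θ :=
    Real.sqrt_pos.2 (div_pos (mul_pos hc (by linarith)) ha)
  rw [phi1_eq]
  positivity

theorem exists_phi1_bounds {a α β : ℝ} (ha : 0 < a) (hα : Real.arctan 2 < α)
    (hβ : β < Real.pi / 2) :
    ∃ c > 0, ∃ C, ∀ θ ∈ Icc α β, c ≤ phi1 a θ ∧ phi1 a θ ≤ C := by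
  rcases lt_or_ge β α with hlt | hle
  · exact ⟨1, one_pos, 1, by simp [Icc_eq_empty_of_lt hlt]⟩
  have hc : ContinuousOn (phi1 a) (Icc α β) := by
    have h1 : phi1 a = fun θ =>
        phi0 a θ * (Real.cos θ / (Real.sin θ - 2 * Real.cos θ)) / (2 * a) := funext (phi1_eq a)
    rw [h1]
    unfold phi0
    refine ContinuousOn.div_const (ContinuousOn.mul (by fun_prop) ?_) _
    exact ContinuousOn.div (by fun_prop) (by fun_prop) fun θ hθ =>
      (sin_sub_two_mul_cos_pos (hα.trans_le hθ.1) (hθ.2.trans hβ.le)).ne'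
  obtain ⟨x, hx, hmin⟩ := isCompact_Icc.exists_isMinOn (nonempty_Icc.2 hle) hc
  obtain ⟨y, hy, hmax⟩ := isCompact_Icc.exists_isMaxOn (nonempty_Icc.2 hle) hc
  exact ⟨_, phi1_pos ha (hα.trans_le hx.1) (hx.2.trans_lt hβ), _,
    fun θ hθ => ⟨hmin hθ, hmax hθ⟩⟩

end Brusselator

theorem mainTheorem4 (a : ℝ) (ha : 0 < a) (θ₁ θ₂ : ℝ)
    (h₁ : Real.arctan 2 < θ₁) (h₁₂ : θ₁ < θ₂) (h₂ : θ₂ ≤ Real.pi / 2)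
    (S : ℝ → Set (ℝ × ℝ)) (hS : Brusselator.IsSlowManifold a θ₁ θ₂ S) :
    ∃ (l u : ℝ → ℝ) (φ : ℝ → ℝ → ℝ),
      Tendsto l (𝓝[>] 0) (𝓝 θ₁) ∧ Tendsto u (𝓝[>] 0) (𝓝 θ₂) ∧
      (θ₂ = Real.pi / 2 → ∀ᶠ ε in 𝓝[>] (0 : ℝ), u ε = Real.pi / 2) ∧
      (∀ᶠ ε in 𝓝[>] (0 : ℝ), S ε = (fun θ => (θ, φ ε θ)) '' Icc (l ε) (u ε)) ∧
      (∀ η > 0, ∀ᶠ ε in 𝓝[>] (0 : ℝ), ∀ θ ∈ Icc (l ε) (u ε),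
        |φ ε θ - (Brusselator.phi0 a θ + ε * Brusselator.phi1 a θ)| ≤ η * ε) ∧
      (∀ α β : ℝ, Real.arctan 2 < α → β < Real.pi / 2 →
        ∃ c > 0, ∃ C > 0, ∀ᶠ ε in 𝓝[>] (0 : ℝ), ∀ θ ∈ Icc (l ε) (u ε) ∩ Icc α β,
          c * ε ≤ |φ ε θ - Brusselator.phi0 a θ| ∧
          |φ ε θ - Brusselator.phi0 a θ| ≤ C * ε) := by
  obtain ⟨γ₀, γ, harc₀, himg₀, hz, ho, hev, ht, htd⟩ := hS
  have h : Brusselator.IsSlowFamily a θ₁ θ₂ γ₀ γ :=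
    { pos := ha, arctan_lt := h₁, lt := h₁₂, le_pi_div_two := h₂, arc₀ := harc₀,
      image₀ := himg₀, apply_zero := hz, apply_one := ho,
      eventually_arc := by
        filter_upwards [hev] with ε hε
        obtain ⟨hA, hSε, hi, hi0⟩ := hε
        rw [hSε] at hi hi0
        exact ⟨hA, hi, hi0⟩
      tendsto := ht, tendsto_deriv := htd }
  let τ : ℝ → ℝ → ℝ := fun ε => Function.invFunOn (fun t => (γ ε t).1) (Icc 0 1)
  have hgraph : ∀ᶠ ε in 𝓝[>] (0 : ℝ),
      (fun t => (γ ε t).1) '' Icc 0 1 = Icc (γ ε 1).1 (γ ε 0).1 ∧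
      γ ε '' Icc 0 1 = (fun θ => (θ, (γ ε (τ ε θ)).2)) '' Icc (γ ε 1).1 (γ ε 0).1 := by
    filter_upwards [h.eventually_arc, h.eventually_graph] with ε h1 h2
    exact Brusselator.image_eq_graph h1.1.contDiffOn.continuousOn h2.1
  have hexp : ∀ η > 0, ∀ᶠ ε in 𝓝[>] (0 : ℝ), ∀ θ ∈ Icc (γ ε 1).1 (γ ε 0).1,
      |(γ ε (τ ε θ)).2 - (Brusselator.phi0 a θ + ε * Brusselator.phi1 a θ)| ≤ η * ε := by
    intro η hη
    filter_upwards [hgraph, h.eventually_expansion hη] with ε h1 h2 θ hθ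
    rw [← h1.1] at hθ
    have e : (γ ε (τ ε θ)).1 = θ := Function.invFunOn_eq hθ
    have := h2 (τ ε θ) (Function.invFunOn_mem hθ)
    rwa [e] at this
  refine ⟨fun ε => (γ ε 1).1, fun ε => (γ ε 0).1, fun ε θ => (γ ε (τ ε θ)).2,
    ?_, ?_, ?_, ?_, hexp, ?_⟩
  · simpa [ho] using h.tendsto_fst (right_mem_Icc.2 zero_le_one)
  · simpa [hz] using h.tendsto_fst (left_mem_Icc.2 zero_le_one)
  · intro hθ
    filter_upwards [h.eventually_apply_zero hθ] with ε hε
    rw [hε.1]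
  · filter_upwards [hgraph, hev] with ε h1 h2
    rw [h2.2.1, h1.2]
  · intro α β hα hβ
    obtain ⟨c, hc, C, hC⟩ := Brusselator.exists_phi1_bounds ha hα hβ
    -- An error of `c / 2 * ε` costs half of the lower bound `c` on `φ₁`; `|C|` is used because `C`
    -- comes without a sign.
    refine ⟨c / 2, half_pos hc, |C| + c, by positivity, ?_⟩
    filter_upwards [hexp (c / 2) (half_pos hc), self_mem_nhdsWithin] with ε h1 hε θ hθ
    have hε : 0 < ε := hε
    have h3 := abs_le.1 (h1 θ hθ.1)
    obtain ⟨h4, h5⟩ := hC θ hθ.2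
    have h6 := mul_le_mul_of_nonneg_left h4 hε.le
    have h7 := mul_le_mul_of_nonneg_left (h5.trans (le_abs_self C)) hε.le
    have h8 := mul_pos hε hc
    have hpos : 0 ≤ (γ ε (τ ε θ)).2 - Brusselator.phi0 a θ := by linarith [h3.1]
    simp only [abs_of_nonneg hpos]
    constructor <;> linarith [h3.1, h3.2]
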